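/- For a continuous function $f:\mathbb R^3\to\mathbb R$, a point $(p,q)\in\mathbb R^2$ and $t>0$ put $$Tf(p,q,t)=\frac1{4\pi}\int_{\mathbf S^2}(1+i\cos\theta)\,f\big((p,q,0)+t\omega\big)\,d\omega ,$$ where $d\omega$ is the surface Lebesgue measure on the unit sphere $\mathbf S^2\subset\mathbb R^3$ and $\theta\in[0,\pi]$ is the polar angle of $\omega\in\mathbf S^2$ measured from the $z$-axis (so $\cos\theta=\omega_3$). **Theorem 1.1.** Let $D\subset\mathbb R^2\cong\{z=0\}$ be a nonempty open set. Then the two-data spherical Radon transform $$f\longmapsto Tf(p,q,t),\qquad (p,q,t)\in D\times(0,\infty),$$ is injective on $C^1(\mathbb R^3)$, the space of all real-valued continuously differentiable functions on $\mathbb R^3$ (no restriction on the support): if $f,g\in C^1(\mathbb R^3)$ and $Tf=Tg$ on $D\times(0,\infty)$, then $f=g$. -/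

import Mathlib

open MeasureTheory

/-- Three-dimensional Euclidean space, with coordinates `x = v 0`, `y = v 1`, `z = v 2`. -/
abbrev R3 : Type := EuclideanSpace ℝ (Fin 3)

/-- The surface (Lebesgue) measure on the unit sphere of `R3`; its total mass is `4 * π`. -/
noncomputable def surfaceMeasure : Measure (Metric.sphere (0 : R3) 1) :=
  (volume : Measure R3).toSphere

/-- The two-data spherical Radon transform of a real function `f`, as a function of the centre
`(p, q, 0)` and the radius `t`:
`Tf (p, q, t) = (1 / 4π) ∫_{S²} (1 + i cos θ) f ((p, q, 0) + t ω) dω`.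
The polar angle `θ` of `ω` is measured from the `z`-axis, so `cos θ` is the third coordinate
of `ω`. -/
noncomputable def twoDataTransform (f : R3 → ℝ) (x : (ℝ × ℝ) × ℝ) : ℂ :=
  (1 / (4 * (Real.pi : ℂ))) *
    ∫ ω : Metric.sphere (0 : R3) 1,
      (1 + Complex.I * (((ω : R3) 2 : ℝ) : ℂ)) *
        ((f ((!₂[x.1.1, x.1.2, 0] : R3) + x.2 • (ω : R3)) : ℝ) : ℂ) ∂surfaceMeasure

/-! Real and imaginary parts of the transform give the means of `f` and of `ω 2 * f` over spheres
centred in `D`. On such a sphere `z = t * ω 2`, so for `h = f - g` both `h` and `z * h` have zero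
means, hence are orthogonal to radial functions about every centre. Moving the centre inside `D` and
differentiating inserts factors `x` and `y`; by Weierstrass approximation, any continuous functions
of `x` and of `y` (`comp_inner_mul`). Together with the distance to one centre these separate points
up to `z ↦ -z`, so even parts vanish (`add_planeReflection_eq_zero`). -/

section RadialAnnihilation

open Set Filter Topology
open scoped InnerProductSpace

/-! ### Orthogonality to radial functions -/

lemma le_norm_sub_sq_of_notMem_closedBall {V : Type*} [SeminormedAddCommGroup V] {x c : V}
    {R : ℝ}
    (hx : x ∉ Metric.closedBall c (|R| + 1)) : R ≤ ‖x - c‖ ^ 2 := by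
  rw [Metric.mem_closedBall, dist_eq_norm, not_le] at hx
  nlinarith [le_abs_self R, abs_nonneg R]

lemma hasCompactSupport_mul_radial {V : Type*} [SeminormedAddCommGroup V] [ProperSpace V]
    {φ : ℝ → ℝ} {R : ℝ} (hR : ∀ s, R ≤ s → φ s = 0)
    (w : V → ℝ) (c : V) : HasCompactSupport fun x => w x * φ (‖x - c‖ ^ 2) :=
  .intro (isCompact_closedBall c (|R| + 1)) fun x hx => by
    simp only [hR _ (le_norm_sub_sq_of_notMem_closedBall hx), mul_zero]

variable {E : Type*} [NormedAddCommGroup E] [InnerProductSpace ℝ E] [FiniteDimensional ℝ E]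
  [MeasurableSpace E] [BorelSpace E]

/-- `w` is orthogonal to every compactly supported continuous function which is radial about a
point of `C`. -/
def RadiallyAnnihilated (C : Set E) (w : E → ℝ) : Prop :=
  ∀ c ∈ C, ∀ (φ : ℝ → ℝ) (R : ℝ), Continuous φ → (∀ s, R ≤ s → φ s = 0) →
    ∫ x, w x * φ (‖x - c‖ ^ 2) = 0

lemma integrable_mul_radial {φ : ℝ → ℝ} {R : ℝ} (hφ : Continuous φ)
    (hR : ∀ s, R ≤ s → φ s = 0) {w : E → ℝ} (hw : Continuous w) (c : E) :
    Integrable fun x => w x * φ (‖x - c‖ ^ 2) :=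
  Continuous.integrable_of_hasCompactSupport (by fun_prop) (hasCompactSupport_mul_radial hR w c)

namespace RadiallyAnnihilated

variable {C : Set E} {w v : E → ℝ}

lemma add (hw : RadiallyAnnihilated C w) (hv : RadiallyAnnihilated C v) (hwc : Continuous w)
    (hvc : Continuous v) : RadiallyAnnihilated C fun x => w x + v x := by
  intro c hc φ R hφ hR
  simp only [add_mul]
  rw [integral_add (integrable_mul_radial hφ hR hwc c) (integrable_mul_radial hφ hR hvc c),
    hw c hc φ R hφ hR, hv c hc φ R hφ hR, add_zero]

lemma const_mul (hw : RadiallyAnnihilated C w) (a : ℝ) :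
    RadiallyAnnihilated C fun x => a * w x := by
  intro c hc φ R hφ hR
  simp only [mul_assoc]
  rw [integral_const_mul, hw c hc φ R hφ hR, mul_zero]

lemma comp_linearIsometryEquiv (hw : RadiallyAnnihilated C w) (σ : E ≃ₗᵢ[ℝ] E)
    (hσ : ∀ c ∈ C, σ c = c) : RadiallyAnnihilated C fun x => w (σ x) := by
  intro c hc φ R hφ hR
  have h := σ.measurePreserving.integral_comp σ.toHomeomorph.measurableEmbedding
    fun x => w x * φ (‖x - c‖ ^ 2)
  rw [hw c hc φ R hφ hR] at h
  rw [← h]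
  refine integral_congr_ae (.of_forall fun x => ?_)
  beta_reduce
  rw [← σ.norm_map (x - c), map_sub, hσ c hc]

/-- Translating the centre in the direction `e` and differentiating produces the factor
`⟪e, x⟫`. -/
lemma inner_mul (hw : RadiallyAnnihilated C w) (hwc : Continuous w) {e : E}
    (he : ∀ c ∈ C, ∀ᶠ s : ℝ in 𝓝 0, c + s • e ∈ C) :
    RadiallyAnnihilated C fun x => ⟪e, x⟫_ℝ * w x := by
  intro c hc φ R hφ hR
  -- The base point `R` makes this antiderivative vanish beyond `R`, so it is again an admissible
  -- profile.
  set Φ : ℝ → ℝ := fun s => ∫ τ in R..s, φ τ with hΦ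
  have hΦd (s : ℝ) : HasDerivAt Φ (φ s) s :=
    intervalIntegral.integral_hasDerivAt_right (hφ.intervalIntegrable _ _)
      (hφ.stronglyMeasurableAtFilter _ _) hφ.continuousAt
  have hΦc : Continuous Φ := continuous_iff_continuousAt.2 fun s => (hΦd s).continuousAt
  have hΦR (s : ℝ) (hs : R ≤ s) : Φ s = 0 := by
    rw [hΦ]
    refine (intervalIntegral.integral_congr fun τ hτ => ?_).trans intervalIntegral.integral_zero
    rw [uIcc_of_le hs] at hτ
    exact hR τ hτ.1
  let F : ℝ → E → ℝ := fun s x => w x * Φ (‖x - (c + s • e)‖ ^ 2)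
  let F' : ℝ → E → ℝ := fun s x =>
    w x * (φ (‖x - (c + s • e)‖ ^ 2) * (2 * ⟪x - (c + s • e), -e⟫_ℝ))
  have hF'c : Continuous (Function.uncurry F') := by unfold F' Function.uncurry; fun_prop
  -- Contains the supports for all `|s| ≤ 1`, giving an integrable dominating function.
  let K : Set E := Metric.closedBall c (|R| + 1 + ‖e‖)
  have hK : IsCompact K := isCompact_closedBall _ _
  obtain ⟨M, hM⟩ := (isCompact_Icc (a := (-1 : ℝ)) (b := 1)).prod hK
    |>.exists_bound_of_continuousOn hF'c.continuousOn
  have key := hasDerivAt_integral_of_dominated_loc_of_deriv_le (F := F) (F' := F') (x₀ := (0 : ℝ))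
    (s := Icc (-1) 1) (bound := K.indicator fun _ => M) (μ := volume)
    (Icc_mem_nhds (by norm_num) (by norm_num))
    (.of_forall fun s => (integrable_mul_radial hΦc hΦR hwc _).aestronglyMeasurable)
    (integrable_mul_radial hΦc hΦR hwc _)
    (hF'c.comp (Continuous.prodMk_right 0)).aestronglyMeasurable
    (.of_forall fun x s hs => ?_)
    ((integrable_indicator_iff hK.measurableSet).2
      (integrableOn_const hK.measure_lt_top.ne))
    (.of_forall fun x s _ => ?_)
  · have hzero : (fun s => ∫ x, F s x) =ᶠ[𝓝 0] fun _ => 0 :=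
      (he c hc).mono fun s hs => hw _ hs Φ R hΦc hΦR
    have h0 : ∫ x, F' 0 x = 0 :=
      key.2.unique ((hasDerivAt_const (0 : ℝ) (0 : ℝ)).congr_of_eventuallyEq hzero)
    have hsplit (x : E) : ⟪e, x⟫_ℝ * w x * φ (‖x - c‖ ^ 2)
        = (-1 / 2) * F' 0 x + ⟪e, c⟫_ℝ * (w x * φ (‖x - c‖ ^ 2)) := by
      simp only [F', zero_smul, add_zero, inner_neg_right, inner_sub_left]
      rw [real_inner_comm x e, real_inner_comm c e]
      ring
    simp only [hsplit]
    rw [integral_add (key.1.const_mul _) ((integrable_mul_radial hφ hR hwc c).const_mul _),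
      integral_const_mul, integral_const_mul, h0, hw c hc φ R hφ hR]
    simp
  · by_cases hx : x ∈ K
    · rw [indicator_of_mem hx]
      exact hM (s, x) ⟨hs, hx⟩
    · rw [indicator_of_notMem hx]
      have hxs : x ∉ Metric.closedBall (c + s • e) (|R| + 1) := by
        intro h
        apply hx
        rw [Metric.mem_closedBall] at h ⊢
        refine (dist_triangle _ (c + s • e) _).trans (add_le_add h ?_)
        rw [dist_self_add_left, norm_smul, Real.norm_eq_abs]
        exact mul_le_of_le_one_left (norm_nonneg _) (abs_le.2 hs)
      simp [F', hR _ (le_norm_sub_sq_of_notMem_closedBall hxs)]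
  · have h1 : HasDerivAt (fun s : ℝ => x - (c + s • e)) (-e) s := by
      simpa using (((hasDerivAt_id s).smul_const e).const_add c).const_sub x
    exact ((hΦd _).comp s h1.norm_sq).const_mul _

lemma polynomial_inner_mul (hw : RadiallyAnnihilated C w) (hwc : Continuous w) {e : E}
    (he : ∀ c ∈ C, ∀ᶠ s : ℝ in 𝓝 0, c + s • e ∈ C) (p : Polynomial ℝ) :
    RadiallyAnnihilated C fun x => p.eval ⟪e, x⟫_ℝ * w x := by
  induction p using Polynomial.induction_on' with
  | add p q hp hq =>
    simp only [Polynomial.eval_add, add_mul]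
    exact hp.add hq (by fun_prop) (by fun_prop)
  | monomial n a =>
    simp only [Polynomial.eval_monomial, mul_assoc]
    refine const_mul ?_ a
    induction n with
    | zero => simpa using hw
    | succ n ih =>
      simp only [pow_succ', mul_assoc]
      exact ih.inner_mul (by fun_prop) he

lemma comp_inner_mul (hw : RadiallyAnnihilated C w) (hwc : Continuous w) {e : E}
    (he : ∀ c ∈ C, ∀ᶠ s : ℝ in 𝓝 0, c + s • e ∈ C) {g : ℝ → ℝ} (hg : Continuous g) :
    RadiallyAnnihilated C fun x => g ⟪e, x⟫_ℝ * w x := by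
  intro c hc φ R hφ hR
  set I : ℝ := ∫ x, ‖w x * φ (‖x - c‖ ^ 2)‖
  have hI : 0 ≤ I := integral_nonneg fun _ => norm_nonneg _
  have hint := integrable_mul_radial hφ hR hwc c
  obtain ⟨A, hA⟩ := (isCompact_closedBall c (|R| + 1)).exists_bound_of_continuousOn
    (f := fun x => ⟪e, x⟫_ℝ) (by fun_prop)
  have bound (ε : ℝ) (hε : 0 < ε) : ‖∫ x, g ⟪e, x⟫_ℝ * w x * φ (‖x - c‖ ^ 2)‖ ≤ ε * I := by
    obtain ⟨p, hp⟩ := exists_polynomial_near_of_continuousOn (-A) A g hg.continuousOn ε hε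
    have hsub : ∫ x, g ⟪e, x⟫_ℝ * w x * φ (‖x - c‖ ^ 2)
        = ∫ x, (g ⟪e, x⟫_ℝ * w x * φ (‖x - c‖ ^ 2)
          - p.eval ⟪e, x⟫_ℝ * w x * φ (‖x - c‖ ^ 2)) := by
      rw [integral_sub (integrable_mul_radial hφ hR (by fun_prop) c)
        (integrable_mul_radial hφ hR (by fun_prop) c),
        hw.polynomial_inner_mul hwc he p c hc φ R hφ hR, sub_zero]
    rw [hsub, ← integral_const_mul]
    refine norm_integral_le_of_norm_le (hint.norm.const_mul ε) (.of_forall fun x => ?_)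
    by_cases hx : x ∈ Metric.closedBall c (|R| + 1)
    · rw [← sub_mul, ← sub_mul, mul_assoc, norm_mul, norm_sub_rev]
      gcongr
      exact (hp _ (abs_le.1 (hA x hx))).le
    · simp [hR _ (le_norm_sub_sq_of_notMem_closedBall hx)]
  by_contra hne
  have hpos := norm_pos_iff.2 hne
  -- The `+ 1` keeps the divisor positive when `I = 0`.
  have := bound (‖∫ x, g ⟪e, x⟫_ℝ * w x * φ (‖x - c‖ ^ 2)‖ / (2 * (I + 1))) (by positivity)
  rw [div_mul_eq_mul_div, le_div_iff₀ (by positivity)] at this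
  nlinarith

end RadiallyAnnihilated

/-- In polar coordinates, a function with vanishing mean over every sphere about a point of `C`
annihilates the radial functions about that point. -/
lemma radiallyAnnihilated_of_sphere_integral_eq_zero [Nontrivial E] {C : Set E} {w : E → ℝ}
    (h : ∀ c ∈ C, ∀ t : ℝ, 0 < t →
      ∫ ω : Metric.sphere (0 : E) 1, w (c + t • (ω : E)) ∂(volume : Measure E).toSphere = 0) :
    RadiallyAnnihilated C w := by
  intro c hc φ R _ _
  rw [← integral_add_left_eq_self _ c]
  simp only [add_sub_cancel_left]
  set μ : Measure E := volume
  let G : Metric.sphere (0 : E) 1 × Ioi (0 : ℝ) → ℝ :=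
    fun z => w (c + z.2.1 • (z.1 : E)) * φ (z.2.1 ^ 2)
  have hpolar : ∫ x, w (c + x) * φ (‖x‖ ^ 2) ∂μ
      = ∫ z, G z ∂(μ.toSphere.prod (.volumeIoiPow (Module.finrank ℝ E - 1))) := by
    rw [← restrict_compl_singleton (μ := μ) 0,
      ← integral_subtype_comap (measurableSet_singleton _).compl
        fun x => w (c + x) * φ (‖x‖ ^ 2), restrict_compl_singleton,
      ← μ.measurePreserving_homeomorphUnitSphereProd.integral_comp
      (Homeomorph.measurableEmbedding _) G]
    refine integral_congr_ae (.of_forall fun x => ?_)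
    have hx : ‖(x : E)‖ ≠ 0 := norm_ne_zero_iff.2 x.2
    simp [G, smul_smul, hx]
  rw [hpolar]
  by_cases hG : Integrable G (μ.toSphere.prod (.volumeIoiPow (Module.finrank ℝ E - 1)))
  · rw [integral_prod_symm _ hG]
    refine (integral_congr_ae (.of_forall fun t => ?_)).trans (integral_zero _ ℝ)
    simp only [G]
    rw [integral_mul_const, h c hc t t.2, zero_mul]
  -- A non-integrable function has integral `0` by convention.
  · exact integral_undef hG

end RadialAnnihilation

/-! ### Centres in the plane `z = 0` -/

section Plane

open Set Filter Topology

/-- The reflection of `R3` in the plane `z = 0`. -/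
noncomputable def planeReflection : R3 ≃ₗᵢ[ℝ] R3 :=
  LinearIsometryEquiv.piLpCongrRight 2
    ![LinearIsometryEquiv.refl ℝ ℝ, LinearIsometryEquiv.refl ℝ ℝ, LinearIsometryEquiv.neg ℝ]

lemma planeReflection_apply (x : R3) : planeReflection x = !₂[x 0, x 1, -x 2] := by
  ext i
  fin_cases i <;> simp [planeReflection]

/-- The points of the plane `z = 0` whose first two coordinates lie in `D`. -/
def planeCenters (D : Set (ℝ × ℝ)) : Set R3 := {c | (c 0, c 1) ∈ D ∧ c 2 = 0}

lemma planeReflection_eq_self {x : R3} (hx : x 2 = 0) : planeReflection x = x := by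
  rw [planeReflection_apply]
  ext i
  fin_cases i <;> simp [hx]

lemma planeReflection_planeReflection (x : R3) : planeReflection (planeReflection x) = x := by
  simp only [planeReflection_apply]
  ext i
  fin_cases i <;> simp

lemma eventually_add_smul_mem_planeCenters {D : Set (ℝ × ℝ)} (hD : IsOpen D) {e : R3}
    (he : e 2 = 0) {c : R3} (hc : c ∈ planeCenters D) :
    ∀ᶠ s : ℝ in 𝓝 0, c + s • e ∈ planeCenters D := by
  have hcont : ContinuousAt (fun s : ℝ => (c 0 + s * e 0, c 1 + s * e 1)) 0 := by fun_prop
  filter_upwards [hcont.eventually_mem (hD.mem_nhds (by simpa using hc.1))] with s hs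
  exact ⟨by simpa using hs, by simp [hc.2, he]⟩

/-- An even function of `z` depends continuously on `x`, `y` and the squared distance to a point
of the plane `z = 0`. -/
lemma eq_comp_norm_sub_sq_of_even {w : R3 → ℝ} (heven : ∀ x, w (planeReflection x) = w x)
    {c : R3} (hc : c 2 = 0) (x : R3) :
    w !₂[x 0, x 1, √(‖x - c‖ ^ 2 - (x 0 - c 0) ^ 2 - (x 1 - c 1) ^ 2)] = w x := by
  have h : ‖x - c‖ ^ 2 - (x 0 - c 0) ^ 2 - (x 1 - c 1) ^ 2 = x 2 ^ 2 := by
    rw [EuclideanSpace.norm_sq_eq, Fin.sum_univ_three]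
    simp [hc]
    ring
  rw [h, Real.sqrt_sq_eq_abs]
  rcases abs_choice (x 2) with h | h <;> rw [h]
  · congr 1
    ext i
    fin_cases i <;> rfl
  · rw [← planeReflection_apply, heven]

/-- If `w a ≠ 0`, tents in `x`, `y` and the squared distance to one centre localise to points where
`w` has the sign of `w a`, so a vanishing integral would be positive. -/
lemma RadiallyAnnihilated.eq_zero_of_even {D : Set (ℝ × ℝ)} (hD : IsOpen D) (hne : D.Nonempty)
    {w : R3 → ℝ} (hw : RadiallyAnnihilated (planeCenters D) w) (hwc : Continuous w)
    (heven : ∀ x, w (planeReflection x) = w x) (a : R3) : w a = 0 := by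
  by_contra ha
  obtain ⟨d, hd⟩ := hne
  let c : R3 := !₂[d.1, d.2, 0]
  have hc : c ∈ planeCenters D := ⟨hd, rfl⟩
  -- `√` is `0` on negative reals, so `W` is continuous on the whole space.
  let W : ℝ × ℝ × ℝ → ℝ := fun u =>
    w !₂[u.1, u.2.1, √(u.2.2 - (u.1 - c 0) ^ 2 - (u.2.1 - c 1) ^ 2)]
  have hW : Continuous W := by
    refine hwc.comp ((PiLp.continuous_toLp 2 _).comp (continuous_pi fun i => ?_))
    fin_cases i <;> simp <;> fun_prop
  let u : R3 → ℝ × ℝ × ℝ := fun x => (x 0, x 1, ‖x - c‖ ^ 2)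
  have hWu (x : R3) : W (u x) = w x := eq_comp_norm_sub_sq_of_even heven hc.2 x
  have hopen : IsOpen {v | 0 < w a * W v} := isOpen_lt continuous_const (by fun_prop)
  obtain ⟨η, hη, hball⟩ := Metric.isOpen_iff.1 hopen (u a) (by
    simpa [hWu] using mul_self_pos.2 ha)
  let b : ℝ → ℝ → ℝ := fun m s => max 0 (η - |s - m|)
  have hbc (m : ℝ) : Continuous (b m) := by fun_prop
  have hb0 (m s : ℝ) : 0 ≤ b m s := le_max_left _ _
  have hb (m s : ℝ) (h : b m s ≠ 0) : dist s m < η := by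
    by_contra! hs
    exact h (max_eq_left (by rw [Real.dist_eq] at hs; linarith))
  have hbm (m : ℝ) : b m m = η := by simp [b, hη.le]
  have hbR (m s : ℝ) (hs : m + η ≤ s) : b m s = 0 :=
    max_eq_left (by linarith [le_abs_self (s - m)])
  have hmul := (((hw.comp_inner_mul hwc (e := EuclideanSpace.single 0 1)
    (fun c hc => eventually_add_smul_mem_planeCenters hD (by simp) hc) (hbc (a 0))).comp_inner_mul
    (by fun_prop) (e := EuclideanSpace.single 1 1)
    (fun c hc => eventually_add_smul_mem_planeCenters hD (by simp) hc) (hbc (a 1))).const_mul (w a))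
    c hc (b (‖a - c‖ ^ 2)) _ (hbc _) (hbR _)
  simp only [EuclideanSpace.inner_single_left, map_one, one_mul] at hmul
  refine (Continuous.integral_pos_of_hasCompactSupport_nonneg_nonzero (x := a) ?_
    (hasCompactSupport_mul_radial (hbR _) _ c) (fun x => ?_) ?_).ne' hmul
  · fun_prop
  · by_cases hx : b (a 0) (x 0) ≠ 0 ∧ b (a 1) (x 1) ≠ 0 ∧ b (‖a - c‖ ^ 2) (‖x - c‖ ^ 2) ≠ 0
    · have hmem : u x ∈ Metric.ball (u a) η := by
        simp only [Metric.mem_ball, Prod.dist_eq, max_lt_iff, u]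
        exact ⟨hb _ _ hx.1, hb _ _ hx.2.1, hb _ _ hx.2.2⟩
      have hpos : 0 < w a * W (u x) := hball hmem
      rw [hWu] at hpos
      calc (0 : ℝ) ≤ (w a * w x) * (b (a 0) (x 0) * b (a 1) (x 1)
            * b (‖a - c‖ ^ 2) (‖x - c‖ ^ 2)) :=
          mul_nonneg hpos.le (mul_nonneg (mul_nonneg (hb0 _ _) (hb0 _ _)) (hb0 _ _))
        _ = _ := by ring
    · have : b (a 0) (x 0) = 0 ∨ b (a 1) (x 1) = 0 ∨ b (‖a - c‖ ^ 2) (‖x - c‖ ^ 2) = 0 := by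
        tauto
      rcases this with h | h | h <;> simp [h]
  · simp [hbm, hη.ne', ha]

lemma RadiallyAnnihilated.add_planeReflection_eq_zero {D : Set (ℝ × ℝ)} (hD : IsOpen D)
    (hne : D.Nonempty) {w : R3 → ℝ} (hw : RadiallyAnnihilated (planeCenters D) w)
    (hwc : Continuous w) (x : R3) : w x + w (planeReflection x) = 0 :=
  (hw.add (hw.comp_linearIsometryEquiv planeReflection fun _ hc => planeReflection_eq_self hc.2)
    hwc (by fun_prop)).eq_zero_of_even hD hne (by fun_prop)
    (fun x => by rw [planeReflection_planeReflection, add_comm]) x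

/-- The even part of `z * h` is `z` times the odd part of `h`. -/
lemma eq_zero_of_radiallyAnnihilated_of_mul {D : Set (ℝ × ℝ)} (hD : IsOpen D)
    (hne : D.Nonempty) {h : R3 → ℝ} (hc : Continuous h)
    (h0 : RadiallyAnnihilated (planeCenters D) h)
    (h1 : RadiallyAnnihilated (planeCenters D) fun x => x 2 * h x) (x : R3) : h x = 0 := by
  have e0 := h0.add_planeReflection_eq_zero hD hne hc x
  have e1 := h1.add_planeReflection_eq_zero hD hne (by fun_prop) x
  by_cases hx : x 2 = 0
  · rw [planeReflection_eq_self hx] at e0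
    linarith
  · have hr : planeReflection x 2 = -x 2 := by simp [planeReflection_apply]
    rw [hr] at e1
    refine (mul_eq_zero.1 (?_ : x 2 * h x = 0)).resolve_left hx
    linear_combination (x 2 * e0 + e1) / 2

end Plane

/-! ### From the transform to spherical means -/

instance : IsFiniteMeasure surfaceMeasure := by
  unfold surfaceMeasure
  infer_instance

lemma integrable_surfaceMeasure_of_continuous {F : Type*} [NormedAddCommGroup F]
    {k : Metric.sphere (0 : R3) 1 → F} (hk : Continuous k) : Integrable k surfaceMeasure :=
  hk.integrable_of_hasCompactSupport (.of_compactSpace k)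

lemma twoDataTransform_eq {f : R3 → ℝ} (hf : Continuous f) (p q t : ℝ) :
    twoDataTransform f ((p, q), t) = (1 / (4 * (Real.pi : ℂ))) *
      (((∫ ω : Metric.sphere (0 : R3) 1, f (!₂[p, q, 0] + t • (ω : R3)) ∂surfaceMeasure : ℝ) : ℂ)
        + Complex.I * ((∫ ω : Metric.sphere (0 : R3) 1,
          (ω : R3) 2 * f (!₂[p, q, 0] + t • (ω : R3)) ∂surfaceMeasure : ℝ) : ℂ)) := by
  rw [twoDataTransform, ← integral_complex_ofReal, ← integral_complex_ofReal,
    ← integral_const_mul (μ := surfaceMeasure) Complex.I, ← integral_add]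
  · congr 2 with ω
    push_cast
    ring
  all_goals exact integrable_surfaceMeasure_of_continuous (by fun_prop)

lemma sphere_integrals_eq_of_twoDataTransform_eq {f g : R3 → ℝ} (hf : Continuous f)
    (hg : Continuous g) {p q t : ℝ}
    (h : twoDataTransform f ((p, q), t) = twoDataTransform g ((p, q), t)) :
    (∫ ω : Metric.sphere (0 : R3) 1, f (!₂[p, q, 0] + t • (ω : R3)) ∂surfaceMeasure
      = ∫ ω : Metric.sphere (0 : R3) 1, g (!₂[p, q, 0] + t • (ω : R3)) ∂surfaceMeasure) ∧
    (∫ ω : Metric.sphere (0 : R3) 1, (ω : R3) 2 * f (!₂[p, q, 0] + t • (ω : R3)) ∂surfaceMeasure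
      = ∫ ω : Metric.sphere (0 : R3) 1,
          (ω : R3) 2 * g (!₂[p, q, 0] + t • (ω : R3)) ∂surfaceMeasure) := by
  rw [twoDataTransform_eq hf, twoDataTransform_eq hg] at h
  have h' := mul_left_cancel₀ (by simp [Real.pi_ne_zero]) h
  exact ⟨by simpa using congrArg Complex.re h', by simpa using congrArg Complex.im h'⟩

theorem theorem1p1 (D : Set (ℝ × ℝ)) (hD : IsOpen D) (hne : D.Nonempty) :
    Set.InjOn
      (fun f : R3 → ℝ => Set.domRestrict (D ×ˢ Set.Ioi (0 : ℝ)) (twoDataTransform f))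
      {f : R3 → ℝ | ContDiff ℝ 1 f} := by
  intro f hf g hg hfg
  have hfc : Continuous f := ContDiff.continuous (n := 1) (𝕜 := ℝ) hf
  have hgc : Continuous g := ContDiff.continuous (n := 1) (𝕜 := ℝ) hg
  have means (c : R3) (hc : c ∈ planeCenters D) (t : ℝ) (ht : 0 < t) :=
    sphere_integrals_eq_of_twoDataTransform_eq hfc hgc
      (congrFun hfg ⟨((c 0, c 1), t), hc.1, ht⟩)
  have hcenter (c : R3) (hc : c ∈ planeCenters D) : !₂[c 0, c 1, 0] = c := by
    ext i
    fin_cases i <;> simp [hc.2]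
  funext x
  refine sub_eq_zero.1 (eq_zero_of_radiallyAnnihilated_of_mul hD hne (h := fun x => f x - g x)
    (by fun_prop) ?_ ?_ x) <;>
    refine radiallyAnnihilated_of_sphere_integral_eq_zero fun c hc t ht => ?_ <;>
    have hm := means c hc t ht <;> rw [hcenter c hc] at hm <;> rw [← surfaceMeasure]
  · rw [integral_sub (integrable_surfaceMeasure_of_continuous (by fun_prop))
      (integrable_surfaceMeasure_of_continuous (by fun_prop)), hm.1, sub_self]
  · have hsplit (ω : Metric.sphere (0 : R3) 1) : (c + t • (ω : R3)) 2 *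
        (f (c + t • (ω : R3)) - g (c + t • (ω : R3)))
        = t * ((ω : R3) 2 * f (c + t • (ω : R3)) - (ω : R3) 2 * g (c + t • (ω : R3))) := by
      simp only [PiLp.add_apply, PiLp.smul_apply, hc.2, smul_eq_mul]
      ring
    simp only [hsplit]
    rw [integral_const_mul, integral_sub (integrable_surfaceMeasure_of_continuous (by fun_prop))
      (integrable_surfaceMeasure_of_continuous (by fun_prop)), hm.2, sub_self, mul_zero]
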